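/- Let $E$ be a finite set, let $\mathcal M$ be a matroid on $E$, regarded as the simplicial complex of its independent sets, and let $\mathbb K$ be a field. Let $S=\mathbb K[x_i : i\in E]$ and let $$I_{\mathcal M}=\Big\langle \prod_{i\in F}x_i \;:\; F\subseteq E \text{ not independent in } \mathcal M\Big\rangle\subseteq S$$ be the Stanley–Reisner ideal of $\mathcal M$. The first cotangent cohomology module $T^1(\mathcal M)$ is the cokernel of the natural map $\operatorname{Der}_{\mathbb K}(S,S)\to\operatorname{Hom}_S(I_{\mathcal M},S/I_{\mathcal M})$, $D\mapsto (f\mapsto D(f) \bmod I_{\mathcal M})$. It is graded by $\mathbb Z^E$ (with $\deg x_i=e_i$), and $T^1_{\mathbf c}(\mathcal M)$ denotes its component of degree $\mathbf c\in\mathbb Z^E$. The following are equivalent: 1. $\mathcal M$ is algebraically rigid, that is, $T^1(\mathcal M)=0$. 2. $\mathcal M$ is $\emptyset$-rigid, that is, $T^1_{\mathbf c}(\mathcal M)=0$ for all $\mathbf c\in\mathbb Z^E$ with $c_i\le 0$ for every $i\in E$. 3. Every element of $E$ is a loop or a coloop of $\mathcal M$. 4. $\mathcal M\cong U_{\ell,0}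 * U_{c,c}$ for some $\ell,c\in\mathbb N$, where $0 \in \mathbb N$, $U_{n,k}$ is the uniform matroid on $\{1,\dots,n\}$ whose independent sets are the subsets with at most $k$ elements, and $\Delta*\Gamma=\{F\sqcup G : F\in\Delta,\ G\in\Gamma\}$ is the join of simplicial complexes. -/

import Mathlib

/-- An abstract simplicial complex on the vertex set `σ`: a collection of finite subsets of `σ`
closed under taking subsets. The empty set may be a face, not every `v : σ` need be a face, and the
collection may be empty. -/
structure AbsComplex (σ : Type*) where
  faces : Set (Finset σ)
  down_closed : ∀ ⦃F G : Finset σ⦄, F ∈ faces → G ⊆ F → G ∈ faces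

namespace AbsComplex

/-- The complex `U_{n,k}` on an `n`-element set whose faces are all subsets with at most `k`
elements. -/
def uniform (n k : ℕ) : AbsComplex (Fin n) where
  faces := {F | F.card ≤ k}
  down_closed := fun _ _ hF hGF => (Finset.card_le_card hGF).trans hF

/-- The join `Δ * Γ`, with faces the disjoint unions `F ⊔ G` of faces `F` of `Δ` and `G` of `Γ`. -/
def join {σ τ : Type*} (Δ : AbsComplex σ) (Γ : AbsComplex τ) : AbsComplex (σ ⊕ τ) where
  faces := {H | ∃ F ∈ Δ.faces, ∃ G ∈ Γ.faces, H = F.disjSum G}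
  down_closed := by
    rintro _ H ⟨F, hF, G, hG, rfl⟩ hH
    refine ⟨H.toLeft, Δ.down_closed hF ?_, H.toRight, Γ.down_closed hG ?_,
      H.toLeft_disjSum_toRight.symm⟩
    · intro x hx
      simpa using hH (Finset.mem_toLeft.1 hx)
    · intro x hx
      simpa using hH (Finset.mem_toRight.1 hx)

/-- `Δ ≅ Γ`: there is a bijection of the vertex sets which identifies the faces. -/
def Isomorphic {σ τ : Type*} (Δ : AbsComplex σ) (Γ : AbsComplex τ) : Prop :=
  ∃ e : σ ≃ τ, ∀ F : Finset σ, F.map e.toEmbedding ∈ Γ.faces ↔ F ∈ Δ.faces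

/-- The Stanley-Reisner ideal of `Δ`, generated by the squarefree monomials `∏_{i ∈ F} x_i` for the
nonfaces `F` of `Δ`. -/
noncomputable def stanleyReisnerIdeal (K : Type*) [Field K] {σ : Type*} (Δ : AbsComplex σ) :
    Ideal (MvPolynomial σ K) :=
  Ideal.span {m | ∃ F : Finset σ, F ∉ Δ.faces ∧ m = ∏ i ∈ F, MvPolynomial.X i}

end AbsComplex

/-- The independent sets of a matroid, as a simplicial complex. -/
def Matroid.indepComplex {σ : Type*} (M : Matroid σ) : AbsComplex σ where
  faces := {F | M.Indep (F : Set σ)}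
  down_closed := fun _ _ hF hGF => Matroid.Indep.subset hF (Finset.coe_subset.2 hGF)

namespace CotangentCohomology

variable {K : Type*} [Field K] {σ : Type*}

/-- The natural map `Der_K(S, S) → Hom_S(I, S/I)`, sending a derivation `D` to the map
`f ↦ D f mod I`, where `S = K[x_i : i ∈ σ]`. -/
noncomputable def derToHom (I : Ideal (MvPolynomial σ K)) :
    Derivation K (MvPolynomial σ K) (MvPolynomial σ K) →ₗ[MvPolynomial σ K]
      (I →ₗ[MvPolynomial σ K] (MvPolynomial σ K ⧸ I)) where
  toFun D :=
    { toFun := fun f => Ideal.Quotient.mk I (D (f : MvPolynomial σ K))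
      map_add' := fun f g => by simp
      map_smul' := fun a f => by
        have h : Ideal.Quotient.mk I (f : MvPolynomial σ K) = 0 :=
          Ideal.Quotient.eq_zero_iff_mem.2 f.2
        simp only [SetLike.val_smul, smul_eq_mul, Derivation.leibniz, map_add, map_mul, h,
          zero_mul, add_zero, RingHom.id_apply]
        rfl }
  map_add' D E := by
    ext f
    simp
  map_smul' a D := by
    ext f
    rfl

/-- The first cotangent cohomology module `T¹(S/I)`: the cokernel of
`Der_K(S, S) → Hom_S(I, S/I)`. -/
def T1 (I : Ideal (MvPolynomial σ K)) : Type _ :=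
  (I →ₗ[MvPolynomial σ K] (MvPolynomial σ K ⧸ I)) ⧸ LinearMap.range (derToHom I)

noncomputable instance (I : Ideal (MvPolynomial σ K)) : AddCommGroup (T1 I) :=
  inferInstanceAs (AddCommGroup
    ((I →ₗ[MvPolynomial σ K] (MvPolynomial σ K ⧸ I)) ⧸ LinearMap.range (derToHom I)))

noncomputable instance (I : Ideal (MvPolynomial σ K)) : Module (MvPolynomial σ K) (T1 I) :=
  inferInstanceAs (Module (MvPolynomial σ K)
    ((I →ₗ[MvPolynomial σ K] (MvPolynomial σ K ⧸ I)) ⧸ LinearMap.range (derToHom I)))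

noncomputable instance (I : Ideal (MvPolynomial σ K)) : Module K (T1 I) :=
  inferInstanceAs (Module K
    ((I →ₗ[MvPolynomial σ K] (MvPolynomial σ K ⧸ I)) ⧸ LinearMap.range (derToHom I)))

instance (I : Ideal (MvPolynomial σ K)) : IsScalarTower K (MvPolynomial σ K) (T1 I) :=
  inferInstanceAs (IsScalarTower K (MvPolynomial σ K)
    ((I →ₗ[MvPolynomial σ K] (MvPolynomial σ K ⧸ I)) ⧸ LinearMap.range (derToHom I)))

/-- The quotient map `Hom_S(I, S/I) → T¹(S/I)`. -/
noncomputable def toT1 (I : Ideal (MvPolynomial σ K)) :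
    (I →ₗ[MvPolynomial σ K] (MvPolynomial σ K ⧸ I)) →ₗ[MvPolynomial σ K] T1 I :=
  (LinearMap.range (derToHom I)).mkQ

variable [DecidableEq σ]

/-- The degree `d` component of `S = K[x_i : i ∈ σ]` in the fine grading, in which `x_i` has as
degree the `i`-th unit vector `e_i` of `ℤ^σ`. -/
noncomputable def polyDeg (K : Type*) [Field K] (d : σ → ℤ) : Submodule K (MvPolynomial σ K) :=
  MvPolynomial.weightedHomogeneousSubmodule K (fun i : σ => (Pi.single i 1 : σ → ℤ)) d

/-- The degree `d` component of `S/I`, the image of that of `S` (for a monomial ideal `I`). -/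
noncomputable def quotDeg (I : Ideal (MvPolynomial σ K)) (d : σ → ℤ) :
    Submodule K (MvPolynomial σ K ⧸ I) :=
  (polyDeg K d).map (Ideal.Quotient.mkₐ K I).toLinearMap

/-- The degree `c` component of `Hom_S(I, S/I)` (for a monomial ideal `I`): the homomorphisms that
map each element of `I` of degree `d` into degree `d + c`. -/
noncomputable def homDeg (I : Ideal (MvPolynomial σ K)) (c : σ → ℤ) :
    Submodule K (I →ₗ[MvPolynomial σ K] (MvPolynomial σ K ⧸ I)) where
  carrier := {φ | ∀ (d : σ → ℤ) (f : I), (f : MvPolynomial σ K) ∈ polyDeg K d →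
    φ f ∈ quotDeg I (d + c)}
  add_mem' := fun hφ hψ d f hf => by
    simpa using (quotDeg I (d + c)).add_mem (hφ d f hf) (hψ d f hf)
  zero_mem' := fun d f _ => by simp
  smul_mem' := fun a φ hφ d f hf => by
    simpa using (quotDeg I (d + c)).smul_mem a (hφ d f hf)

/-- The degree `c` component `T¹_c(S/I)` of `T¹(S/I)` (for a monomial ideal `I`): the image of the
degree `c` component of `Hom_S(I, S/I)`. -/
noncomputable def T1Deg (I : Ideal (MvPolynomial σ K)) (c : σ → ℤ) : Submodule K (T1 I) :=
  (homDeg I c).map ((toT1 I).restrictScalars K)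

end CotangentCohomology

namespace AbsComplex

/-- `Δ` is algebraically rigid over `K`: `T¹(Δ) = 0`. -/
def AlgebraicallyRigid (K : Type*) [Field K] {σ : Type*} (Δ : AbsComplex σ) : Prop :=
  ∀ t : CotangentCohomology.T1 (Δ.stanleyReisnerIdeal K), t = 0

/-- `Δ` is `∅`-rigid over `K`: `T¹_c(Δ) = 0` for all `c ∈ ℤ^σ` with `c ≤ 0` in each coordinate. -/
def EmptyRigid (K : Type*) [Field K] {σ : Type*} [DecidableEq σ] (Δ : AbsComplex σ) : Prop :=
  ∀ c : σ → ℤ, c ≤ 0 → CotangentCohomology.T1Deg (Δ.stanleyReisnerIdeal K) c = ⊥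

end AbsComplex

/-! If every element is a loop or a coloop, the ideal is generated by the variables of the loops,
and a derivation may take any values on variables, so every homomorphism to `S/I` comes from one.
Conversely, dividing by `x^b` the monomials divisible by `x^C`, and killing the others, gives a
homomorphism of degree at most `0` whenever `Divisible C b` holds; ∅-rigidity makes it come from a
derivation. Let `C` be a circuit through `v`. Circuit elimination allows `b = {v}`; but a derivation
lowering the exponent of `v` treats all circuits through `v` alike, so `C` is the only one. If `v`
is not a loop, take `w ≠ v` in `C`. By strong elimination every other circuit avoids both `v` and
`w`, so `b = {v, w}` is allowed too. A derivation lowers at most one exponent of a monomial, a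
contradiction. -/

/-- The exponent vector of the squarefree monomial `∏_{i ∈ F} x_i`. -/
noncomputable def Finset.exponent {σ : Type*} (F : Finset σ) : σ →₀ ℕ :=
  ∑ i ∈ F, Finsupp.single i 1

/-! ### Squarefree monomials and their derivatives -/

namespace Finset

variable {σ : Type*} [DecidableEq σ]

theorem exponent_apply (F : Finset σ) (j : σ) : F.exponent j = if j ∈ F then 1 else 0 := by
  simp [exponent, Finsupp.finsetSum_apply, Finsupp.single_apply]

theorem support_exponent (F : Finset σ) : F.exponent.support = F := by
  ext j
  simp [exponent_apply]

theorem exponent_le_iff {F : Finset σ} {m : σ →₀ ℕ} : F.exponent ≤ m ↔ F ⊆ m.support := by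
  constructor
  · intro h j hj
    have := h j
    simp only [exponent_apply, hj, if_true] at this
    simp only [Finsupp.mem_support_iff]
    omega
  · intro h j
    rw [exponent_apply]
    split_ifs with hj
    · exact Nat.one_le_iff_ne_zero.2 (Finsupp.mem_support_iff.1 (h hj))
    · exact Nat.zero_le _

theorem sdiff_subset_support_sub_exponent (F b : Finset σ) {m : σ →₀ ℕ} (h : F ⊆ m.support) :
    F \ b ⊆ (m - b.exponent).support := by
  intro j hj
  rw [Finset.mem_sdiff] at hj
  have := Finsupp.mem_support_iff.1 (h hj.1)
  simpa [exponent_apply, hj.2] using this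

theorem exponent_sub_exponent {F b : Finset σ} :
    F.exponent - b.exponent = (F \ b).exponent := by
  ext j
  by_cases h : j ∈ F <;> by_cases h' : j ∈ b <;> simp [exponent_apply, h, h']

omit [DecidableEq σ] in
theorem monomial_exponent (K : Type*) [Field K] (F : Finset σ) :
    MvPolynomial.monomial F.exponent (1 : K) = ∏ i ∈ F, MvPolynomial.X i := by
  rw [exponent, MvPolynomial.monomial_sum_one]
  rfl

end Finset

namespace MvPolynomial

variable {K : Type*} [Field K] {σ : Type*} [DecidableEq σ]

/-- The coefficient of `x^{F ∖ b}` in `D (x^F)`, for a derivation `D` and `b ⊆ F`: only the partial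
derivatives along those `i` with `b ⊆ {i}` contribute. -/
theorem coeff_derivation_monomial_exponent
    (D : Derivation K (MvPolynomial σ K) (MvPolynomial σ K)) {F b : Finset σ} (hb : b ⊆ F) :
    coeff (F \ b).exponent (D (monomial F.exponent 1)) =
      ∑ i ∈ F, if b ⊆ {i} then coeff ({i} \ b : Finset σ).exponent (D (X i)) else 0 := by
  have hD : D = mkDerivation K (fun i => D (X i)) := by
    apply derivation_ext
    intro i
    simp
  rw [hD, mkDerivation_monomial, one_smul, Finsupp.sum, Finset.support_exponent, coeff_sum]
  simp only [mkDerivation_X]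
  refine Finset.sum_congr rfl fun i hi => ?_
  have hs : (Finsupp.single i 1 : σ →₀ ℕ) = ({i} : Finset σ).exponent := by
    simp [Finset.exponent]
  rw [smul_eq_mul, coeff_monomial_mul', hs, Finset.exponent_sub_exponent,
    Finset.exponent_sub_exponent, Finset.exponent_apply, if_pos hi]
  have h1 : F \ {i} ⊆ F \ b ↔ b ⊆ {i} := by
    constructor
    · intro h j hj
      by_contra hji
      exact (Finset.mem_sdiff.1 (h (Finset.mem_sdiff.2 ⟨hb hj, hji⟩))).2 hj
    · exact fun h => Finset.sdiff_subset_sdiff le_rfl h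
  have h2 : (F \ b) \ (F \ {i}) = {i} \ b := by
    ext j
    simp only [Finset.mem_sdiff, Finset.mem_singleton]
    constructor
    · rintro ⟨⟨h1, h2⟩, h3⟩
      exact ⟨by by_contra h; exact h3 ⟨h1, h⟩, h2⟩
    · rintro ⟨rfl, h⟩
      exact ⟨⟨hi, h⟩, fun h => h.2 rfl⟩
  simp only [Finset.exponent_le_iff, Finset.support_exponent, h1, h2, Nat.cast_one, one_mul]

end MvPolynomial

/-! ### Division homomorphisms and the derivations inducing them -/

namespace AbsComplex

open MvPolynomial

variable {K : Type*} [Field K] {σ : Type*} [DecidableEq σ] {Δ : AbsComplex σ}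

theorem mem_stanleyReisnerIdeal_iff {f : MvPolynomial σ K} :
    f ∈ Δ.stanleyReisnerIdeal K ↔ ∀ m ∈ f.support, m.support ∉ Δ.faces := by
  have h : {m : MvPolynomial σ K | ∃ F : Finset σ, F ∉ Δ.faces ∧ m = ∏ i ∈ F, X i} =
      (fun s => monomial s (1 : K)) '' (Finset.exponent '' Δ.facesᶜ) := by
    ext m
    rw [Set.image_image]
    simp only [Set.mem_ofPred_eq, Set.mem_image, Set.mem_compl_iff, Finset.monomial_exponent,
      eq_comm]
  rw [stanleyReisnerIdeal, h, mem_ideal_span_monomial_image]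
  simp only [Set.exists_mem_image, Finset.exponent_le_iff, Set.mem_compl_iff]
  refine forall₂_congr fun m _ => ⟨?_, fun h => ⟨_, h, subset_rfl⟩⟩
  rintro ⟨F, hF, hFm⟩ hm
  exact hF (Δ.down_closed hm hFm)

theorem monomial_mem_stanleyReisnerIdeal {m : σ →₀ ℕ} (h : m.support ∉ Δ.faces) (r : K) :
    monomial m r ∈ Δ.stanleyReisnerIdeal K := by
  rw [mem_stanleyReisnerIdeal_iff]
  intro n hn
  rw [Finset.mem_singleton.1 (support_monomial_subset hn)]
  exact h

theorem coeff_eq_zero_of_mem_stanleyReisnerIdeal {f : MvPolynomial σ K}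
    (hf : f ∈ Δ.stanleyReisnerIdeal K) {F : Finset σ} (hF : F ∈ Δ.faces) :
    coeff F.exponent f = 0 := by
  by_contra h
  exact mem_stanleyReisnerIdeal_iff.1 hf _ (mem_support_iff.2 h)
    (by rwa [Finset.support_exponent])

/-- The `K`-linear map dividing the monomials divisible by `∏_{i ∈ C} x_i` by `∏_{i ∈ b} x_i` and
killing all other monomials. -/
noncomputable def divMap (K : Type*) [Field K] (C b : Finset σ) :
    MvPolynomial σ K →ₗ[K] MvPolynomial σ K :=
  (basisMonomials σ K).constr K fun m =>
    if C ⊆ m.support then monomial (m - b.exponent) 1 else 0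

theorem divMap_monomial (C b : Finset σ) (m : σ →₀ ℕ) (r : K) :
    divMap K C b (monomial m r) = if C ⊆ m.support then monomial (m - b.exponent) r else 0 := by
  have h : monomial m r = r • basisMonomials σ K m := by simp [smul_monomial]
  rw [h, map_smul, divMap, Module.Basis.constr_basis]
  split_ifs <;> simp [smul_monomial]

/-- Every way of adding a nonface to `C` and removing `b` gives a nonface, unless the nonface
contains `C`. -/
def Divisible (Δ : AbsComplex σ) (C b : Finset σ) : Prop :=
  b ⊆ C ∧ ∀ D : Finset σ, D ∉ Δ.faces → ¬ C ⊆ D → (C ∪ D) \ b ∉ Δ.faces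

/-- Linearity modulo the ideal can fail only at a term `x^m` of `f` with `x^C` dividing `x^(n+m)`
but not `x^m`. The quotient by `x^b` then has support containing `(C ∪ supp m) \ b`, a nonface by
hypothesis. -/
theorem Divisible.divMap_mul_sub_mem {C b : Finset σ} (h : Δ.Divisible C b)
    (p : MvPolynomial σ K) {f : MvPolynomial σ K} (hf : f ∈ Δ.stanleyReisnerIdeal K) :
    divMap K C b (p * f) - p * divMap K C b f ∈ Δ.stanleyReisnerIdeal K := by
  induction p using MvPolynomial.induction_on' with
  | add p q hp hq =>
    have : divMap K C b ((p + q) * f) - (p + q) * divMap K C b f =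
      (divMap K C b (p * f) - p * divMap K C b f) +
      (divMap K C b (q * f) - q * divMap K C b f) := by
      rw [add_mul, map_add]; ring
    rw [this]
    exact add_mem hp hq
  | monomial n a =>
    rw [mem_stanleyReisnerIdeal_iff] at hf
    rw [f.as_sum, Finset.mul_sum, map_sum, map_sum, Finset.mul_sum, ← Finset.sum_sub_distrib]
    refine sum_mem fun m hm => ?_
    rw [monomial_mul, divMap_monomial, divMap_monomial]
    have hle : m.support ⊆ (n + m).support := Finsupp.support_mono le_add_self
    by_cases hC : C ⊆ m.support
    · rw [if_pos (hC.trans hle), if_pos hC, monomial_mul,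
        add_tsub_assoc_of_le (Finset.exponent_le_iff.2 (h.1.trans hC)), sub_self]
      exact zero_mem _
    · rw [if_neg hC, mul_zero, sub_zero]
      split_ifs with hC'
      · refine monomial_mem_stanleyReisnerIdeal (fun hF => h.2 _ (hf m hm) hC ?_) _
        exact Δ.down_closed hF (Finset.sdiff_subset_support_sub_exponent _ _
          (Finset.union_subset hC' hle))
      · exact zero_mem _

/-- The homomorphism `I → S/I` induced by `divMap`. -/
noncomputable def Divisible.hom (K : Type*) [Field K] {C b : Finset σ} (h : Δ.Divisible C b) :
    Δ.stanleyReisnerIdeal K →ₗ[MvPolynomial σ K]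
      (MvPolynomial σ K ⧸ Δ.stanleyReisnerIdeal K) where
  toFun f := Ideal.Quotient.mk _ (divMap K C b f)
  map_add' f g := by simp
  map_smul' p f := by
    rw [RingHom.id_apply, SetLike.val_smul, smul_eq_mul]
    exact Ideal.Quotient.eq.2 (h.divMap_mul_sub_mem p f.2)

open CotangentCohomology

theorem Divisible.hom_mem_homDeg {C b : Finset σ} (h : Δ.Divisible C b) :
    h.hom K ∈ homDeg (Δ.stanleyReisnerIdeal K)
      (-Finsupp.weight (fun i : σ => (Pi.single i 1 : σ → ℤ)) b.exponent) := by
  intro d f hf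
  refine ⟨divMap K C b f, ?_, rfl⟩
  rw [SetLike.mem_coe, (f : MvPolynomial σ K).as_sum, map_sum]
  refine sum_mem fun m hm => ?_
  rw [divMap_monomial]
  split_ifs with hC
  · refine (mem_weightedHomogeneousSubmodule K _ _ _).2 (isWeightedHomogeneous_monomial _ _ _ ?_)
    rw [← hf (mem_support_iff.1 hm), ← sub_eq_add_neg, eq_sub_iff_add_eq, ← map_add,
      tsub_add_cancel_of_le (Finset.exponent_le_iff.2 (h.1.trans hC))]
  · exact zero_mem _

/-- If `Δ` is `∅`-rigid, then `Divisible.hom` comes from a derivation. -/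
theorem EmptyRigid.exists_derivation (hΔ : Δ.EmptyRigid K) {C b : Finset σ}
    (h : Δ.Divisible C b) :
    ∃ D : Derivation K (MvPolynomial σ K) (MvPolynomial σ K),
      ∀ f ∈ Δ.stanleyReisnerIdeal K, D f - divMap K C b f ∈ Δ.stanleyReisnerIdeal K := by
  have hc : -Finsupp.weight (fun i : σ => (Pi.single i 1 : σ → ℤ)) b.exponent ≤ 0 := by
    rw [neg_nonpos, Finsupp.weight_apply]
    exact Finset.sum_nonneg fun i _ => nsmul_nonneg (Pi.single_nonneg.2 zero_le_one) _
  have h0 : toT1 _ (h.hom K) ∈ T1Deg (Δ.stanleyReisnerIdeal K) _ :=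
    ⟨h.hom K, h.hom_mem_homDeg, rfl⟩
  rw [hΔ _ hc, Submodule.mem_bot] at h0
  obtain ⟨D, hD⟩ := (Submodule.Quotient.mk_eq_zero _).1 h0
  exact ⟨D, fun f hf => Ideal.Quotient.eq.1 (LinearMap.congr_fun hD ⟨f, hf⟩)⟩

/-- Compare coefficients of `x^(F \ b)`: this monomial survives modulo the ideal because `F \ b` is
a face. Reading off one coefficient spares taking `D` homogeneous. -/
theorem EmptyRigid.exists_derivation_coeff (hΔ : Δ.EmptyRigid K) {C b : Finset σ}
    (h : Δ.Divisible C b) :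
    ∃ D : Derivation K (MvPolynomial σ K) (MvPolynomial σ K),
      ∀ F : Finset σ, F ∉ Δ.faces → b ⊆ F → F \ b ∈ Δ.faces →
        (∑ i ∈ F, if b ⊆ {i} then coeff ({i} \ b : Finset σ).exponent (D (X i)) else 0) =
          if C ⊆ F then 1 else 0 := by
  obtain ⟨D, hD⟩ := hΔ.exists_derivation h
  refine ⟨D, fun F hF hb hFb => ?_⟩
  have := coeff_eq_zero_of_mem_stanleyReisnerIdeal
    (hD _ (monomial_mem_stanleyReisnerIdeal (by rwa [Finset.support_exponent]) 1)) hFb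
  rw [coeff_sub, coeff_derivation_monomial_exponent D hb, divMap_monomial,
    Finset.support_exponent, Finset.exponent_sub_exponent, sub_eq_zero] at this
  rw [this]
  split_ifs <;> simp

/-- No `b` with at least two elements can be removed from a minimal nonface. -/
theorem EmptyRigid.not_divisible (hΔ : Δ.EmptyRigid K) {C b : Finset σ} (hC : C ∉ Δ.faces)
    (hCb : C \ b ∈ Δ.faces) (hb : 1 < b.card) : ¬ Δ.Divisible C b := by
  intro h
  obtain ⟨D, hD⟩ := hΔ.exists_derivation_coeff h
  have := hD C hC h.1 hCb
  rw [if_pos subset_rfl, Finset.sum_eq_zero] at this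
  · exact zero_ne_one this
  · intro i _
    refine if_neg fun hbi => ?_
    have := Finset.card_le_card hbi
    simp at this
    omega

theorem EmptyRigid.subset_of_divisible (hΔ : Δ.EmptyRigid K) {C C' : Finset σ} {v : σ}
    (hC : C ∉ Δ.faces) (hCv : C \ {v} ∈ Δ.faces) (hC' : C' ∉ Δ.faces) (hCv' : C' \ {v} ∈ Δ.faces)
    (hv : v ∈ C') (h : Δ.Divisible C {v}) : C ⊆ C' := by
  obtain ⟨D, hD⟩ := hΔ.exists_derivation_coeff h
  -- The only contribution is the constant term of `D (X v)`, which does not depend on `F`.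
  have key : ∀ F : Finset σ, v ∈ F → (∑ i ∈ F, if ({v} : Finset σ) ⊆ {i} then
      coeff ({i} \ {v} : Finset σ).exponent (D (X i)) else 0) =
        coeff (∅ : Finset σ).exponent (D (X v)) := by
    intro F hF
    rw [Finset.sum_eq_single_of_mem v hF]
    · simp
    · intro i _ hi
      exact if_neg fun hvi => hi (Finset.mem_singleton.1 (hvi (Finset.mem_singleton_self v))).symm
  have h1 := hD C hC h.1 hCv
  have h2 := hD C' hC' (Finset.singleton_subset_iff.2 hv) hCv'
  rw [key _ (Finset.singleton_subset_iff.1 h.1), if_pos subset_rfl] at h1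
  rw [key _ hv, h1] at h2
  by_contra hCC
  rw [if_neg hCC] at h2
  exact one_ne_zero h2

end AbsComplex

theorem LinearMap.ext_span {R M N : Type*} [Semiring R] [AddCommMonoid M] [Module R M]
    [AddCommMonoid N] [Module R N] {s : Set M} (φ ψ : Submodule.span R s →ₗ[R] N)
    (h : ∀ x (hx : x ∈ s), φ ⟨x, Submodule.subset_span hx⟩ = ψ ⟨x, Submodule.subset_span hx⟩) :
    φ = ψ := by
  ext ⟨x, hx⟩
  induction hx using Submodule.span_induction with
  | zero => exact (map_zero φ).trans (map_zero ψ).symm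
  | add p q hp hq h1 h2 =>
    exact (map_add φ ⟨p, hp⟩ ⟨q, hq⟩).trans
      ((congrArg₂ _ h1 h2).trans (map_add ψ ⟨p, hp⟩ ⟨q, hq⟩).symm)
  | smul a p hp h1 =>
    exact (map_smul φ a ⟨p, hp⟩).trans ((congrArg _ h1).trans (map_smul ψ a ⟨p, hp⟩).symm)
  | mem x hx => exact h x hx

/-! ### Ideals generated by variables -/

namespace AbsComplex

open MvPolynomial CotangentCohomology

theorem AlgebraicallyRigid.emptyRigid {K : Type*} [Field K] {σ : Type*} [DecidableEq σ]
    {Δ : AbsComplex σ} (h : Δ.AlgebraicallyRigid K) : Δ.EmptyRigid K :=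
  fun _ _ => (Submodule.eq_bot_iff _).2 fun t _ => h t

theorem derToHom_surjective_of_exists_singleton_notMem (K : Type*) [Field K] {σ : Type*}
    {Δ : AbsComplex σ} (h : ∀ F ∉ Δ.faces, ∃ v ∈ F, {v} ∉ Δ.faces) :
    Function.Surjective (derToHom (Δ.stanleyReisnerIdeal K)) := by
  classical
  intro φ
  have hX : ∀ v : σ, {v} ∉ Δ.faces → (X v : MvPolynomial σ K) ∈ Δ.stanleyReisnerIdeal K :=
    fun v hv => Ideal.subset_span ⟨{v}, hv, (Finset.prod_singleton _ _).symm⟩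
  -- Lifts to `S` of the values of `φ` on the variables in the ideal; the other variables get the
  -- irrelevant value `0`.
  have hg : ∀ v : σ, ∃ g : MvPolynomial σ K, ∀ hv : {v} ∉ Δ.faces,
      Ideal.Quotient.mk (Δ.stanleyReisnerIdeal K) g = φ ⟨X v, hX v hv⟩ := by
    intro v
    by_cases hv : {v} ∈ Δ.faces
    · exact ⟨0, fun hv' => absurd hv hv'⟩
    · obtain ⟨g, hg⟩ := Ideal.Quotient.mk_surjective (φ ⟨X v, hX v hv⟩)
      exact ⟨g, fun _ => hg⟩
  choose g hg using hg
  refine ⟨mkDerivation K g, LinearMap.ext_span _ _ ?_⟩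
  rintro _ ⟨F, hF, rfl⟩
  obtain ⟨v, hvF, hv⟩ := h F hF
  have e : (⟨∏ i ∈ F, X i, Ideal.subset_span ⟨F, hF, rfl⟩⟩ : Δ.stanleyReisnerIdeal K) =
      (∏ i ∈ F.erase v, X i : MvPolynomial σ K) • ⟨X v, hX v hv⟩ :=
    Subtype.ext (Finset.prod_erase_mul F _ hvF).symm
  have hD : derToHom (Δ.stanleyReisnerIdeal K) (mkDerivation K g) ⟨X v, hX v hv⟩ =
      φ ⟨X v, hX v hv⟩ := by
    refine Eq.trans ?_ (hg v hv)
    exact congrArg (Ideal.Quotient.mk (Δ.stanleyReisnerIdeal K)) (mkDerivation_X K g v)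
  have hψ : ∀ ψ : Δ.stanleyReisnerIdeal K →ₗ[MvPolynomial σ K]
      (MvPolynomial σ K ⧸ Δ.stanleyReisnerIdeal K),
      ψ ⟨∏ i ∈ F, X i, Ideal.subset_span ⟨F, hF, rfl⟩⟩ =
        (∏ i ∈ F.erase v, X i : MvPolynomial σ K) • ψ ⟨X v, hX v hv⟩ :=
    fun ψ => (congrArg ψ e).trans (map_smul ψ _ _)
  exact (hψ _).trans ((congrArg _ hD).trans (hψ φ).symm)

/-- A complex whose Stanley-Reisner ideal is generated by variables is algebraically rigid. -/
theorem algebraicallyRigid_of_exists_singleton_notMem (K : Type*) [Field K] {σ : Type*}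
    {Δ : AbsComplex σ} (h : ∀ F ∉ Δ.faces, ∃ v ∈ F, {v} ∉ Δ.faces) :
    Δ.AlgebraicallyRigid K := by
  intro t
  obtain ⟨φ, rfl⟩ := Submodule.mkQ_surjective
    (LinearMap.range (derToHom (Δ.stanleyReisnerIdeal K))) t
  exact (Submodule.Quotient.mk_eq_zero
    (LinearMap.range (derToHom (Δ.stanleyReisnerIdeal K)))).2
    (derToHom_surjective_of_exists_singleton_notMem K h φ)

theorem mem_faces_join_uniform_iff {l c : ℕ} {H : Finset (Fin l ⊕ Fin c)} :
    H ∈ ((uniform l 0).join (uniform c c)).faces ↔ ∀ i, Sum.inl i ∉ H := by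
  constructor
  · rintro ⟨F, hF, G, -, rfl⟩ i hi
    have hF0 : F = ∅ := Finset.card_eq_zero.1 (Nat.le_zero.1 hF)
    simp [hF0] at hi
  · intro h
    refine ⟨H.toLeft, ?_, H.toRight, ?_, H.toLeft_disjSum_toRight.symm⟩
    · have : H.toLeft = ∅ := Finset.eq_empty_of_forall_notMem fun i hi =>
        h i (Finset.mem_toLeft.1 hi)
      simp [uniform, this]
    · exact (Finset.card_le_univ _).trans (Fintype.card_fin c).le

end AbsComplex

/-! ### Loops, coloops and circuits -/

namespace Matroid

variable {σ : Type*} {M : Matroid σ}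

theorem mem_faces_indepComplex {F : Finset σ} : F ∈ M.indepComplex.faces ↔ M.Indep (F : Set σ) :=
  Iff.rfl

theorem indep_iff_of_forall_isLoop_or_isColoop (h : ∀ v, M.IsLoop v ∨ M.IsColoop v) {I : Set σ} :
    M.Indep I ↔ ∀ v ∈ I, ¬ M.IsLoop v := by
  refine ⟨fun hI v hv hl => hl.notMem_of_indep hI hv, fun hI => ?_⟩
  refine M.coloops_indep.subset fun v hv => ?_
  exact (h v).resolve_left (hI v hv)

theorem exists_isomorphic_join_of_forall_isLoop_or_isColoop [Finite σ]
    (h : ∀ v, M.IsLoop v ∨ M.IsColoop v) :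
    ∃ l c : ℕ, M.indepComplex.Isomorphic
      ((AbsComplex.uniform l 0).join (AbsComplex.uniform c c)) := by
  classical
  obtain ⟨l, ⟨e₁⟩⟩ := Finite.exists_equiv_fin {v // M.IsLoop v}
  obtain ⟨c, ⟨e₂⟩⟩ := Finite.exists_equiv_fin {v // ¬ M.IsLoop v}
  refine ⟨l, c, (Equiv.sumCompl M.IsLoop).symm.trans (e₁.sumCongr e₂), fun F => ?_⟩
  rw [AbsComplex.mem_faces_join_uniform_iff, mem_faces_indepComplex,
    indep_iff_of_forall_isLoop_or_isColoop h]
  simp only [Finset.mem_map_equiv, Equiv.symm_trans_apply, Equiv.sumCongr_symm, Equiv.symm_symm,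
    Equiv.sumCongr_apply, Sum.map_inl, Equiv.sumCompl_apply_inl, SetLike.mem_coe]
  constructor
  · intro hF v hv hl
    exact hF (e₁ ⟨v, hl⟩) (by simpa using hv)
  · exact fun hF i hi => hF _ hi (e₁.symm i).2

theorem forall_isLoop_or_isColoop_of_isomorphic_join [Finite σ] (hM : M.E = Set.univ) {l c : ℕ}
    (h : M.indepComplex.Isomorphic ((AbsComplex.uniform l 0).join (AbsComplex.uniform c c)))
    (v : σ) : M.IsLoop v ∨ M.IsColoop v := by
  classical
  obtain ⟨e, he⟩ := h
  have hI : ∀ F : Finset σ, M.Indep (F : Set σ) ↔ ∀ w ∈ F, ¬ (e w).isLeft := by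
    intro F
    rw [← mem_faces_indepComplex, ← he, AbsComplex.mem_faces_join_uniform_iff]
    simp only [Finset.mem_map_equiv]
    constructor
    · intro hF w hw hl
      obtain ⟨i, hi⟩ := Sum.isLeft_iff.1 hl
      exact hF i (by rwa [← hi, Equiv.symm_apply_apply])
    · exact fun hF i hi => hF _ hi (by simp)
  have hv : v ∈ M.E := hM ▸ Set.mem_univ v
  by_cases hl : (e v).isLeft
  · left
    rw [← singleton_not_indep hv, ← Finset.coe_singleton, hI]
    simpa using hl
  · right
    rw [isColoop_iff_forall_notMem_isCircuit hv]
    intro C hC hvC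
    lift C to Finset σ using C.toFinite
    have h1 := hC.sdiff_singleton_indep hvC
    rw [← Finset.coe_singleton, ← Finset.coe_sdiff, hI] at h1
    refine hC.not_indep ((hI C).2 fun w hw => ?_)
    by_cases hwv : w = v
    · rwa [hwv]
    · exact h1 w (by simp [hw, hwv])

section

variable [Finite σ] [DecidableEq σ]

/-- Divisibility need only be tested on circuits, since every dependent set contains one. -/
theorem IsCircuit.divisible (hM : M.E = Set.univ) {C b : Finset σ}
    (hb : b ⊆ C) (h : ∀ D : Finset σ, M.IsCircuit (D : Set σ) → D ≠ C →
      ∃ D' : Finset σ, M.IsCircuit (D' : Set σ) ∧ D' ⊆ (C ∪ D) \ b) :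
    M.indepComplex.Divisible C b := by
  refine ⟨hb, fun D hD hCD hI => ?_⟩
  rw [mem_faces_indepComplex, not_indep_iff (hM ▸ Set.subset_univ _)] at hD
  obtain ⟨D₀, hD₀, hc⟩ := hD.exists_isCircuit_subset
  lift D₀ to Finset σ using D₀.toFinite
  rw [Finset.coe_subset] at hD₀
  obtain ⟨D', hD', hs⟩ := h D₀ hc (fun e => hCD (e ▸ hD₀))
  refine hD'.not_indep (Indep.subset hI (Finset.coe_subset.2 (hs.trans ?_)))
  exact Finset.sdiff_subset_sdiff (Finset.union_subset_union_right hD₀) subset_rfl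

theorem isLoop_or_isColoop_of_emptyRigid {K : Type*} [Field K] (hM : M.E = Set.univ)
    (hK : M.indepComplex.EmptyRigid K) (v : σ) : M.IsLoop v ∨ M.IsColoop v := by
  have hv : v ∈ M.E := hM ▸ Set.mem_univ v
  rw [isColoop_iff_forall_notMem_isCircuit hv, or_iff_not_imp_right]
  intro h
  push Not at h
  obtain ⟨C, hC, hvC⟩ := h
  lift C to Finset σ using C.toFinite
  have hdel : ∀ D : Finset σ, M.IsCircuit (D : Set σ) → v ∈ D →
      D \ {v} ∈ M.indepComplex.faces := by
    intro D hD hvD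
    rw [mem_faces_indepComplex, Finset.coe_sdiff, Finset.coe_singleton]
    exact hD.sdiff_singleton_indep hvD
  have hdiv : M.indepComplex.Divisible C {v} := by
    refine IsCircuit.divisible hM (Finset.singleton_subset_iff.2 hvC) fun D hD hne => ?_
    obtain ⟨D', hs, hD'⟩ := hC.elimination hD (fun e => hne (Finset.coe_injective e).symm) v
    lift D' to Finset σ using D'.toFinite
    exact ⟨D', hD', by rw [Finset.sdiff_singleton_eq_erase]; exact_mod_cast hs⟩
  have huniq : ∀ D : Finset σ, M.IsCircuit (D : Set σ) → v ∈ D → D = C := by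
    intro D hD hvD
    have hs := hK.subset_of_divisible hC.not_indep (hdel C hC hvC) hD.not_indep (hdel D hD hvD)
      hvD hdiv
    exact Finset.coe_injective (hC.eq_of_subset_isCircuit hD (Finset.coe_subset.2 hs)).symm
  by_contra hl
  obtain ⟨w, hw, hwv⟩ : ∃ w ∈ C, w ≠ v := by
    by_contra! hw
    have hCv : C = {v} := Finset.eq_singleton_iff_unique_mem.2 ⟨hvC, hw⟩
    rw [hCv, Finset.coe_singleton, singleton_isCircuit] at hC
    exact hl hC
  refine hK.not_divisible (b := {v, w}) hC.not_indep
    (M.indepComplex.down_closed (hdel C hC hvC) (Finset.sdiff_subset_sdiff subset_rfl (by simp)))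
    (by rw [Finset.card_pair hwv.symm]; omega) ?_
  refine IsCircuit.divisible hM (by simp [Finset.insert_subset_iff, hw, Finset.mem_coe.1 hvC])
    fun D hD hne => ⟨D, hD, ?_⟩
  -- It remains to see that `D` avoids `{v, w}`, so that it survives the removal of `b`.
  have hvD : v ∉ D := fun h => hne (huniq D hD h)
  have hwD : w ∉ D := by
    intro hwD
    -- Eliminating `w` while keeping `v` gives a circuit through `v` that misses `w`, hence differs
    -- from `C`.
    obtain ⟨D', hs, hD', hvD'⟩ := hC.strong_elimination hD (Finset.mem_coe.2 hw) hwD hvC hvD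
    lift D' to Finset σ using D'.toFinite
    have := huniq D' hD' hvD'
    exact (hs (Finset.mem_coe.2 (this ▸ hw))).2 rfl
  intro x hx
  have hxv : x ≠ v := fun e => hvD (e ▸ hx)
  have hxw : x ≠ w := fun e => hwD (e ▸ hx)
  simp [hx, hxv, hxw]

end

end Matroid

theorem mainTheorem4 (K : Type*) [Field K] {σ : Type*} [Finite σ] [DecidableEq σ]
    (M : Matroid σ) (hM : M.E = Set.univ) :
    List.TFAE
      [M.indepComplex.AlgebraicallyRigid K,
       M.indepComplex.EmptyRigid K,
       ∀ v : σ, M.IsLoop v ∨ M.IsColoop v,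
       ∃ l c : ℕ, M.indepComplex.Isomorphic
         ((AbsComplex.uniform l 0).join (AbsComplex.uniform c c))] := by
  tfae_have 1 → 2 := AbsComplex.AlgebraicallyRigid.emptyRigid
  tfae_have 2 → 3 := Matroid.isLoop_or_isColoop_of_emptyRigid hM
  tfae_have 3 → 1 := by
    intro h
    refine AbsComplex.algebraicallyRigid_of_exists_singleton_notMem K fun F hF => ?_
    rw [Matroid.mem_faces_indepComplex, Matroid.indep_iff_of_forall_isLoop_or_isColoop h] at hF
    push Not at hF
    obtain ⟨v, hvF, hv⟩ := hF
    refine ⟨v, hvF, fun hI => ?_⟩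
    rw [Matroid.mem_faces_indepComplex] at hI
    exact hv.notMem_of_indep hI (by simp)
  tfae_have 3 → 4 := Matroid.exists_isomorphic_join_of_forall_isLoop_or_isColoop
  tfae_have 4 → 3 := fun ⟨_, _, h⟩ => Matroid.forall_isLoop_or_isColoop_of_isomorphic_join hM h
  tfae_finish
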